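/- Let $n\ge 1$, let $0<\alpha_1<\alpha_2<\dots<\alpha_n\le 2$ with $\alpha_1<2$, let $H\in(0,1)$, and let $B^H=\{B^H(x):x\in\mathbb R\}$ be a fractional Brownian motion with Hurst index $H$ on a probability space, i.e. a centered Gaussian process with covariance $\mathbb E[B^H(x)B^H(y)]=\frac12(|x|^{2H}+|y|^{2H}-|x-y|^{2H})$. For $\omega\in\mathbb R$ put $s=\sum_{k=1}^n(\mathrm i\omega)^{\alpha_k}$ (principal values), $D=(0,1)$, and let $G_\omega$ be the Green function of $\partial_{xx}-s$ on $D$ with the boundary conditions $\partial_xG_\omega(0,y)=0$, $G_\omega(1,y)=0$, that is $$G_\omega(x,y)=\begin{cases}\max\{x,y\}-1,&\omega=0,\\[2pt] \dfrac{e^{\sqrt s(x+y)}+e^{\sqrt s|x-y|}-e^{\sqrt s(2-x-y)}-e^{\sqrt s(2-|x-y|)}}{2\sqrt s\,(1+e^{2\sqrt s})},&\omega\ne0,\end{cases}$$ with the principal square root. For a deterministic function $g\in L^1(\mathbb R)$ the stochastic integral $\int g\,\mathrm dB^H$ is the mean square limit of the elementary integrals $\sum_i c_i(B^H(b_i)-B^H(a_i))$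 of complex step functions $\varphi_k=\sum_i c_i1_{(a_i,b_i]}$ with $\int_{\mathbb R}|\hat\varphi_k(\zeta)-\hat g(\zeta)|^2|\zeta|^{1-2H}\,\mathrm d\zeta\to0$, where $\hat g(\zeta)=\int g(y)e^{-\mathrm i\zeta y}\,\mathrm dy$, whenever such step functions and such a limit exist; an integral over $D$ is that of the extension by zero. (a) For every $\omega\in\mathbb R$ the stochastic integral $\int_D G_\omega(0,y)\,\mathrm dB^H(y)$ exists, is unique up to almost sure equality, and $$R(\omega):=\mathbb E\left|\int_D G_\omega(0,y)\,\mathrm dB^H(y)\right|^2>0 .$$ (b) Let $f\in L^2(0,\infty)$ be a deterministic real- or complex-valued source, let $\hat f$ be any version of the $L^2$ Fourier transform $\hat f(\omega)=\int f(t)e^{-\mathrm i\omega t}\,\mathrm dt$ of its extension by zero, and let $$\hat u(x,\omega)=-\hat f(\omega)\int_D G_\omega(x,y)\,\mathrm dB^H(y)$$ be the mild solution of $\hat u_{xx}-s\hat u=-\hat f(\omega)\dot B^H$ in $D$, $\partial_x\hat u(0,\omega)=0$, $\hat u(1,\omega)=0$. Then for every $\omega\in\mathbb R$ $$|\hat f(\omega)|=\left(\frac{\mathbb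 V[\hat u(0,\omega)]}{R(\omega)}\right)^{1/2},\qquad \mathbb V[X]:=\mathbb E|X-\mathbb E X|^2 .$$ (c) Consequently $|\hat f|$ is uniquely determined by the variance of the boundary data: if $f_1,f_2\in L^2(0,\infty)$ are two sources with Fourier transforms $\hat f_1,\hat f_2$ and $\hat u_1,\hat u_2$ are the corresponding mild solutions, driven by the same or by two different fractional Brownian motions of Hurst index $H$ (possibly on different probability spaces), then for every $\omega\in\mathbb R$, $\mathbb V[\hat u_1(0,\omega)]=\mathbb V[\hat u_2(0,\omega)]$ implies $|\hat f_1(\omega)|=|\hat f_2(\omega)|$. -/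

import Mathlib

open MeasureTheory ProbabilityTheory Filter Topology
open scoped ENNReal FourierTransform

noncomputable section

namespace RandomSource

/-! ### Fractional Brownian motion and the stochastic integral -/

/-- `B` is a fractional Brownian motion on the whole line with Hurst index `H` under `P`:
a centered Gaussian process with covariance `(|x|^{2H} + |y|^{2H} - |x-y|^{2H}) / 2`. -/
structure IsFBM {Ω : Type*} [MeasurableSpace Ω] (H : ℝ) (B : ℝ → Ω → ℝ) (P : Measure Ω) :
    Prop where
  gaussian : IsGaussianProcess B P
  centered : ∀ x, ∫ w, B x w ∂P = 0
  covariance : ∀ x y, ∫ w, B x w * B y w ∂P =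
    (|x| ^ (2 * H) + |y| ^ (2 * H) - |x - y| ^ (2 * H)) / 2

/-- A complex step function `∑ i, c i * 1_{(a i, b i]}` on the line (given by its data). -/
structure StepFn where
  size : ℕ
  c : Fin size → ℂ
  a : Fin size → ℝ
  b : Fin size → ℝ
  le : ∀ i, a i ≤ b i

/-- The function represented by the data of a step function. -/
def StepFn.toFun (φ : StepFn) (y : ℝ) : ℂ :=
  ∑ i, (Set.Ioc (φ.a i) (φ.b i)).indicator (fun _ => φ.c i) y

/-- The elementary stochastic integral `∑ i, c i * (B (b i) - B (a i))`. -/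
def StepFn.integral {Ω : Type*} (φ : StepFn) (B : ℝ → Ω → ℝ) (w : Ω) : ℂ :=
  ∑ i, φ.c i * ((B (φ.b i) w - B (φ.a i) w : ℝ) : ℂ)

/-- The Fourier transform `∫ g(y) e^{-iζy} dy` of an integrable function. -/
def fourierInt (g : ℝ → ℂ) (ζ : ℝ) : ℂ :=
  ∫ y, g y * Complex.exp (-(Complex.I * ζ * y))

/-- The square `∫ |ĝ(ζ)|² |ζ|^{1-2H} dζ` of the seminorm of the homogeneous fractional Sobolev
space of order `1/2 - H`. -/
def sobolevSq (H : ℝ) (g : ℝ → ℂ) : ℝ≥0∞ :=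
  ∫⁻ ζ : ℝ, ‖fourierInt g ζ‖ₑ ^ 2 * ENNReal.ofReal (|ζ| ^ (1 - 2 * H))

/-- `J` is (a version of) the stochastic integral over the line of the deterministic integrable
function `g` with respect to `B`: a mean square limit of elementary integrals of step functions
that converge to `g` in the (semi)norm of order `1/2 - H`. -/
def IsStochIntegral {Ω : Type*} [MeasurableSpace Ω] (H : ℝ) (B : ℝ → Ω → ℝ) (P : Measure Ω)
    (g : ℝ → ℂ) (J : Ω → ℂ) : Prop :=
  Integrable g ∧ MemLp J 2 P ∧ ∃ φ : ℕ → StepFn,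
    Tendsto (fun k => sobolevSq H (fun y => g y - (φ k).toFun y)) atTop (𝓝 0) ∧
    Tendsto (fun k => eLpNorm (fun w => J w - (φ k).integral B w) 2 P) atTop (𝓝 0)

open Classical in
/-- The stochastic integral over the line of `g` with respect to `B` (a version of it), where it
exists. -/
def stochIntegral {Ω : Type*} [MeasurableSpace Ω] (H : ℝ) (B : ℝ → Ω → ℝ) (P : Measure Ω)
    (g : ℝ → ℂ) : Ω → ℂ :=
  if h : ∃ J, IsStochIntegral H B P g J then h.choose else 0

/-! ### The Green function in the frequency domain -/

/-- `s = ∑ₖ (iω)^{αₖ}`, with principal values. -/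
def freqSymbol {n : ℕ} (α : Fin n → ℝ) (ω : ℝ) : ℂ :=
  ∑ k, (Complex.I * (ω : ℂ)) ^ ((α k : ℝ) : ℂ)

/-- The principal square root of `s`. -/
def sqrtSymbol {n : ℕ} (α : Fin n → ℝ) (ω : ℝ) : ℂ :=
  freqSymbol α ω ^ (1 / 2 : ℂ)

/-- The Green function `G_ω(x, y)` of `∂ₓₓ G - s G = δ(x - y)` on `(0,1)` with
`∂ₓ G(0, y) = 0` and `G(1, y) = 0`. -/
def green {n : ℕ} (α : Fin n → ℝ) (ω x y : ℝ) : ℂ :=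
  if ω = 0 then ((max x y - 1 : ℝ) : ℂ)
  else
    let r := sqrtSymbol α ω
    (Complex.exp (r * (x + y : ℝ)) + Complex.exp (r * (|x - y| : ℝ))
        - Complex.exp (r * (2 - x - y : ℝ)) - Complex.exp (r * (2 - |x - y| : ℝ)))
      / (2 * r * (1 + Complex.exp (2 * r)))

/-- The zero extension of `G_ω(x, ·)` from `D = (0,1)` to the line. -/
def greenExt {n : ℕ} (α : Fin n → ℝ) (ω x : ℝ) : ℝ → ℂ :=
  (Set.Ioo (0 : ℝ) 1).indicator (green α ω x)

/-- `∫_D G_ω(x, y) dB^H(y)`. -/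
def greenIntegral {Ω : Type*} [MeasurableSpace Ω] {n : ℕ} (H : ℝ) (B : ℝ → Ω → ℝ)
    (P : Measure Ω) (α : Fin n → ℝ) (ω x : ℝ) : Ω → ℂ :=
  stochIntegral H B P (greenExt α ω x)

/-- `R(ω) = E |∫_D G_ω(0, y) dB^H(y)|²`. -/
def R {Ω : Type*} [MeasurableSpace Ω] {n : ℕ} (H : ℝ) (B : ℝ → Ω → ℝ) (P : Measure Ω)
    (α : Fin n → ℝ) (ω : ℝ) : ℝ :=
  ∫ w, ‖greenIntegral H B P α ω 0 w‖ ^ 2 ∂P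

/-! ### Sources, the mild solution, and its variance -/

/-- `F` is a version of the Fourier transform `f̂(ω) = ∫ f(t) e^{-iωt} dt` of the zero extension
to the line of a source `f ∈ L²(0,∞)`. (Mathlib's transform has the kernel `e^{-2πiξt}`.) -/
def IsSourceFourier (f F : ℝ → ℂ) : Prop :=
  ∃ h : MemLp ((Set.Ioi (0 : ℝ)).indicator f) 2 (volume : Measure ℝ),
    F =ᵐ[volume] fun ω => (𝓕 (h.toLp _) : Lp ℂ 2 (volume : Measure ℝ)) (ω / (2 * Real.pi))

/-- The mild solution `û(x, ω) = - f̂(ω) ∫_D G_ω(x, y) dB^H(y)` of the boundary value problem in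
the frequency domain; `F` is the Fourier transform of the source. -/
def mildSolution {Ω : Type*} [MeasurableSpace Ω] {n : ℕ} (H : ℝ) (B : ℝ → Ω → ℝ)
    (P : Measure Ω) (α : Fin n → ℝ) (F : ℝ → ℂ) (x ω : ℝ) (w : Ω) : ℂ :=
  -F ω * greenIntegral H B P α ω x w

/-- The variance `E |X - E X|²` of a complex random variable. -/
def cVar {Ω : Type*} [MeasurableSpace Ω] (X : Ω → ℂ) (P : Measure Ω) : ℝ :=
  ∫ w, ‖X w - ∫ w', X w' ∂P‖ ^ 2 ∂P

end RandomSource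

end

namespace RandomSource

/-! ### Power weights on the line -/

/-! Everything rests on an isometry: the seminorm of an integrand with weight `|ζ|^(1-2H)` is a
fixed positive multiple of the `L²(P)` norm of its stochastic integral. An elementary integral is `∑
d j * B (x j)` with `∑ d j = 0`. In its second moment the covariance terms that depend on one node
only cancel, leaving the kernel `-|x j - x k|^(2H) / 2`. Scaling in `∫ (1 - cos (uζ)) |ζ|^(-1-2H)
dζ` shows that this integral is `oscConst H * |u|^(2H)`. So the second moment is a weighted integral
of `|∑ d j * exp (-iζ x j)|²`, and that sum is the Fourier transform of the step function up to the
factor `-iζ` (`StepFn.sobolevSq_eq_integral`).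

The isometry passes to limits (`IsStochIntegral.sobolevNorm_eq`). It gives uniqueness, makes
approximable integrands integrable by completeness, and shows that `R` depends on the integrand and
`H` alone.

On `(0,1)` the function `G_ω(0, ·)` agrees with a `C¹` function, and interpolation by step functions
converges to it: the Fourier transform of the error tends to 0 pointwise and is `O(1/|ζ|)`
uniformly, so dominated convergence applies for every `H` in `(0,1)`. For `R > 0` it suffices that
the continuous Fourier transform of `G_ω(0, ·)` is nonzero at 0, that is, that its mean is nonzero.
For `ω ≠ 0` and `r = √s` the mean is `-(e^r - 1)² / (r² (1 + e^{2r}))`, which is nonzero because `Im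
s ≠ 0` forces `Re r ≠ 0`.

Finally, the integral is centered, so the variance of the boundary data is `|f̂(ω)|² R(ω)`; parts
(b) and (c) follow. -/

lemma integrable_of_even_of_integrableOn_Ioi {f : ℝ → ℝ} (hf : ∀ x, f (-x) = f x)
    (h : IntegrableOn f (Set.Ioi 0)) : Integrable f := by
  rw [← integrableOn_univ, ← Set.Iic_union_Ioi (a := (0 : ℝ))]
  refine IntegrableOn.union ?_ h
  rw [integrableOn_Iic_iff_integrableOn_Iio]
  have := ((Measure.measurePreserving_neg (volume : Measure ℝ)).integrableOn_comp_preimage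
    (Homeomorph.neg ℝ).measurableEmbedding (f := f) (s := Set.Ioi 0)).2 h
  simpa [Function.comp_def, hf] using this

/-- `H < 1` makes the singularity at 0 integrable; `H > 0` gives the decay `|ζ|^(-1-2H)` needed at
infinity. -/
lemma integrable_weight {H : ℝ} (hH : H ∈ Set.Ioo (0 : ℝ) 1) :
    Integrable fun ζ : ℝ => (1 + ζ ^ 2)⁻¹ * |ζ| ^ (1 - 2 * H) := by
  refine integrable_of_even_of_integrableOn_Ioi (fun x => by simp) ?_
  have hm : Measurable fun ζ : ℝ => (1 + ζ ^ 2)⁻¹ * |ζ| ^ (1 - 2 * H) := by fun_prop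
  rw [← Set.Ioc_union_Ioi_eq_Ioi (zero_le_one' ℝ)]
  refine IntegrableOn.union ?_ ?_
  · have h := (intervalIntegral.intervalIntegrable_rpow' (a := 0) (b := 1) (r := 1 - 2 * H)
      (by linarith [hH.2])).1
    refine Integrable.mono' h hm.aestronglyMeasurable ?_
    refine (ae_restrict_iff' measurableSet_Ioc).2 (.of_forall fun x hx => ?_)
    rw [Real.norm_of_nonneg (by positivity), abs_of_pos hx.1]
    refine mul_le_of_le_one_left (Real.rpow_nonneg hx.1.le _) (inv_le_one_of_one_le₀ ?_)
    nlinarith [sq_nonneg x]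
  · have h := integrableOn_Ioi_rpow_of_lt (a := -1 - 2 * H) (c := 1) (by linarith [hH.1]) one_pos
    refine Integrable.mono' h hm.aestronglyMeasurable ?_
    refine (ae_restrict_iff' measurableSet_Ioi).2 (.of_forall fun x hx => ?_)
    have hx0 : (0 : ℝ) < x := one_pos.trans hx
    rw [Real.norm_of_nonneg (by positivity), abs_of_pos hx0,
      show (-1 - 2 * H : ℝ) = (1 - 2 * H) - 2 by ring, Real.rpow_sub hx0 (1 - 2 * H) 2,
      Real.rpow_two, div_eq_inv_mul]
    gcongr
    linarith

lemma rpow_split {H ζ : ℝ} (hζ : ζ ≠ 0) :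
    |ζ| ^ (-1 - 2 * H) = |ζ| ^ (1 - 2 * H) / ζ ^ 2 := by
  rw [show (-1 - 2 * H : ℝ) = (1 - 2 * H) - 2 by ring, Real.rpow_sub (abs_pos.2 hζ),
    Real.rpow_two, sq_abs]

/-- The normalising constant `∫ (1 - cos ζ) |ζ|^{-1-2H} dζ`. -/
noncomputable def oscConst (H : ℝ) : ℝ := ∫ ζ : ℝ, (1 - Real.cos ζ) * |ζ| ^ (-1 - 2 * H)

lemma integrable_one_sub_cos {H : ℝ} (hH : H ∈ Set.Ioo (0 : ℝ) 1) :
    Integrable fun ζ : ℝ => (1 - Real.cos ζ) * |ζ| ^ (-1 - 2 * H) := by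
  -- Since `1 - cos ζ` is at most both `ζ²/2` and `2`, its product with `1 + ζ²` is at most `5/2 *
  -- ζ²`; 4 is a convenient larger constant.
  refine Integrable.mono' ((integrable_weight hH).const_mul 4) (by fun_prop)
    (.of_forall fun ζ => ?_)
  have h0 : 0 ≤ 1 - Real.cos ζ := by linarith [Real.cos_le_one ζ]
  rw [Real.norm_of_nonneg (by positivity)]
  rcases eq_or_ne ζ 0 with rfl | hζ
  · simp; positivity
  rw [rpow_split hζ, ← mul_assoc, ← mul_div_assoc, mul_div_right_comm]
  gcongr
  have h1 := Real.one_sub_sq_div_two_le_cos (x := ζ)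
  have h2 := Real.neg_one_le_cos ζ
  rw [← div_eq_mul_inv, div_le_div_iff₀ (by positivity) (by positivity)]
  nlinarith [sq_nonneg ζ]

lemma integrable_one_sub_cos_mul {H : ℝ} (hH : H ∈ Set.Ioo (0 : ℝ) 1) (u : ℝ) :
    Integrable fun ζ : ℝ => (1 - Real.cos (u * ζ)) * |ζ| ^ (-1 - 2 * H) := by
  rcases eq_or_ne u 0 with rfl | hu
  · simp
  have h := ((integrable_one_sub_cos hH).comp_mul_left' hu).const_mul (|u| ^ (1 + 2 * H))
  refine h.congr (.of_forall fun ζ => ?_)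
  have hu' : |u| ^ (1 + 2 * H) * |u| ^ (-1 - 2 * H) = 1 := by
    rw [← Real.rpow_add (abs_pos.2 hu)]; simp
  simp only [abs_mul, Real.mul_rpow (abs_nonneg u) (abs_nonneg ζ)]
  linear_combination ((1 - Real.cos (u * ζ)) * |ζ| ^ (-1 - 2 * H)) * hu'

lemma integral_one_sub_cos_mul {H : ℝ} (hH : H ∈ Set.Ioo (0 : ℝ) 1) (u : ℝ) :
    ∫ ζ : ℝ, (1 - Real.cos (u * ζ)) * |ζ| ^ (-1 - 2 * H) = oscConst H * |u| ^ (2 * H) := by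
  rcases eq_or_ne u 0 with rfl | hu
  · have : (2 * H) ≠ 0 := by linarith [hH.1]
    simp [Real.zero_rpow this]
  have h := Measure.integral_comp_mul_left
    (fun ζ : ℝ => (1 - Real.cos ζ) * |ζ| ^ (-1 - 2 * H)) u
  have hu' : |u| ^ (1 + 2 * H) * |u| ^ (-1 - 2 * H) = 1 := by
    rw [← Real.rpow_add (abs_pos.2 hu)]; simp
  calc _ = ∫ ζ : ℝ, |u| ^ (1 + 2 * H) * ((1 - Real.cos (u * ζ)) * |u * ζ| ^ (-1 - 2 * H)) := by
        refine integral_congr_ae (.of_forall fun ζ => ?_)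
        simp only [abs_mul, Real.mul_rpow (abs_nonneg u) (abs_nonneg ζ)]
        linear_combination -((1 - Real.cos (u * ζ)) * |ζ| ^ (-1 - 2 * H)) * hu'
    _ = |u| ^ (1 + 2 * H) * (|u⁻¹| * oscConst H) := by
        rw [integral_const_mul, h, smul_eq_mul, oscConst]
    _ = _ := by
        rw [Real.rpow_add (abs_pos.2 hu), Real.rpow_one, abs_inv]
        field_simp [abs_ne_zero.2 hu]

lemma oscConst_pos {H : ℝ} (hH : H ∈ Set.Ioo (0 : ℝ) 1) : 0 < oscConst H := by
  have h0 : ∀ ζ : ℝ, 0 ≤ 1 - Real.cos ζ := fun ζ => by linarith [Real.cos_le_one ζ]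
  rw [oscConst, integral_pos_iff_support_of_nonneg
    (fun ζ => mul_nonneg (h0 ζ) (by positivity)) (integrable_one_sub_cos hH)]
  refine lt_of_lt_of_le ?_ (measure_mono (s := Set.Ioo 0 1) fun ζ hζ => ?_)
  · simp
  · have h1 : Real.cos ζ < 1 := by
      simpa using Real.cos_lt_cos_of_nonneg_of_le_pi (x := 0) (y := ζ) le_rfl
        (by linarith [Real.pi_gt_three, hζ.2]) hζ.1
    have h2 : 0 < |ζ| ^ (-1 - 2 * H) := Real.rpow_pos_of_pos (abs_pos.2 hζ.1.ne') _
    exact (mul_pos (by linarith) h2).ne'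

/-! ### Trigonometric sums -/

lemma normSq_sum {ι : Type*} [Fintype ι] (z : ι → ℂ) :
    ‖∑ j, z j‖ ^ 2 = ∑ j, ∑ k, (z j * (starRingEnd ℂ) (z k)).re := by
  rw [← Complex.normSq_eq_norm_sq, ← Complex.ofReal_re (Complex.normSq _), ← Complex.mul_conj,
    map_sum, Finset.sum_mul_sum, Complex.re_sum]
  exact Finset.sum_congr rfl fun j _ => Complex.re_sum _ _

lemma sum_re_mul_conj_eq_zero {ι : Type*} [Fintype ι] {d : ι → ℂ} (hd : ∑ j, d j = 0) :
    ∑ j, ∑ k, (d j * (starRingEnd ℂ) (d k)).re = 0 := by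
  rw [← normSq_sum, hd]; simp

/-- For complex coefficients the expanded square also has sine terms. They are odd in `ζ`, so adding
the value at `-ζ` removes them. The vanishing coefficient sum then allows `cos` to be replaced by
`cos - 1`, which is integrable against the singular weight. -/
lemma normSq_trigSum_add_neg {ι : Type*} [Fintype ι] {d : ι → ℂ} (hd : ∑ j, d j = 0)
    (x : ι → ℝ) (ζ : ℝ) :
    ‖∑ j, d j * Complex.exp (-(Complex.I * ζ * x j))‖ ^ 2
      + ‖∑ j, d j * Complex.exp (-(Complex.I * (-ζ : ℝ) * x j))‖ ^ 2
    = ∑ j, ∑ k, -2 * (d j * (starRingEnd ℂ) (d k)).re * (1 - Real.cos ((x j - x k) * ζ)) := by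
  have key : ∀ (ζ : ℝ) (j k : ι), (d j * Complex.exp (-(Complex.I * ζ * x j)) *
      (starRingEnd ℂ) (d k * Complex.exp (-(Complex.I * ζ * x k)))).re =
      (d j * (starRingEnd ℂ) (d k)).re * Real.cos ((x j - x k) * ζ)
      + (d j * (starRingEnd ℂ) (d k)).im * Real.sin ((x j - x k) * ζ) := by
    intro ζ j k
    have : d j * Complex.exp (-(Complex.I * ζ * x j)) *
      (starRingEnd ℂ) (d k * Complex.exp (-(Complex.I * ζ * x k))) =
      (d j * (starRingEnd ℂ) (d k)) * Complex.exp ((-((x j - x k) * ζ) : ℝ) * Complex.I) := by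
      rw [map_mul, ← Complex.exp_conj]
      simp only [map_neg, map_mul, Complex.conj_I, Complex.conj_ofReal]
      rw [mul_mul_mul_comm, ← Complex.exp_add]
      congr 2
      push_cast
      ring
    rw [this, Complex.mul_re, Complex.exp_ofReal_mul_I_re, Complex.exp_ofReal_mul_I_im,
      Real.cos_neg, Real.sin_neg]
    ring
  simp only [normSq_sum, key]
  have h0 := sum_re_mul_conj_eq_zero hd
  calc _ = ∑ j, ∑ k, (-2 * (d j * (starRingEnd ℂ) (d k)).re * (1 - Real.cos ((x j - x k) * ζ))
        + 2 * (d j * (starRingEnd ℂ) (d k)).re) := by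
        rw [← Finset.sum_add_distrib]
        refine Finset.sum_congr rfl fun j _ => ?_
        rw [← Finset.sum_add_distrib]
        refine Finset.sum_congr rfl fun k _ => ?_
        rw [mul_neg, Real.cos_neg, Real.sin_neg]
        ring
    _ = _ := by
        simp only [Finset.sum_add_distrib, ← Finset.mul_sum, h0]
        ring

lemma integrable_and_integral_normSq_trigSum {H : ℝ} (hH : H ∈ Set.Ioo (0 : ℝ) 1)
    {ι : Type*} [Fintype ι] {d : ι → ℂ} (hd : ∑ j, d j = 0) (x : ι → ℝ) :
    Integrable (fun ζ : ℝ => ‖∑ j, d j * Complex.exp (-(Complex.I * ζ * x j))‖ ^ 2 *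
      |ζ| ^ (-1 - 2 * H)) ∧
    ∫ ζ : ℝ, ‖∑ j, d j * Complex.exp (-(Complex.I * ζ * x j))‖ ^ 2 * |ζ| ^ (-1 - 2 * H) =
      2 * oscConst H *
        ∑ j, ∑ k, -(1 / 2) * (d j * (starRingEnd ℂ) (d k)).re * |x j - x k| ^ (2 * H) := by
  set ψ : ℝ → ℝ := fun ζ => ‖∑ j, d j * Complex.exp (-(Complex.I * ζ * x j))‖ ^ 2 *
    |ζ| ^ (-1 - 2 * H) with hψ
  have hsum : ∀ ζ, ψ ζ + ψ (-ζ) = ∑ j, ∑ k, -2 * (d j * (starRingEnd ℂ) (d k)).re *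
      ((1 - Real.cos ((x j - x k) * ζ)) * |ζ| ^ (-1 - 2 * H)) := by
    intro ζ
    simp only [hψ, abs_neg]
    rw [← add_mul, normSq_trigSum_add_neg hd]
    simp only [Finset.sum_mul, mul_assoc]
  have hI : ∀ j k, Integrable fun ζ : ℝ => -2 * (d j * (starRingEnd ℂ) (d k)).re *
      ((1 - Real.cos ((x j - x k) * ζ)) * |ζ| ^ (-1 - 2 * H)) := fun j k =>
    (integrable_one_sub_cos_mul hH _).const_mul _
  have hint : Integrable fun ζ => ψ ζ + ψ (-ζ) := by
    simp only [hsum]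
    exact integrable_finsetSum _ fun j _ => integrable_finsetSum _ fun k _ => hI j k
  have h0 : ∀ ζ, 0 ≤ ψ ζ := fun ζ => by positivity
  -- Both summands of the symmetrized function are nonnegative, so it dominates `ψ`.
  have hψi : Integrable ψ := by
    refine hint.mono' ?_ (.of_forall fun ζ => ?_)
    · have : Measurable ψ := by fun_prop
      exact this.aestronglyMeasurable
    · rw [Real.norm_of_nonneg (h0 ζ)]
      linarith [h0 (-ζ)]
  refine ⟨hψi, ?_⟩
  have h2 : ∫ ζ, (ψ ζ + ψ (-ζ)) = 2 * ∫ ζ, ψ ζ := by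
    rw [integral_add hψi hψi.comp_neg, integral_neg_eq_self ψ volume]
    ring
  have h3 : ∫ ζ, (ψ ζ + ψ (-ζ)) = ∑ j, ∑ k, -2 * (d j * (starRingEnd ℂ) (d k)).re *
      (oscConst H * |x j - x k| ^ (2 * H)) := by
    simp only [hsum]
    rw [integral_finsetSum _ fun j _ => integrable_finsetSum _ fun k _ => hI j k]
    refine Finset.sum_congr rfl fun j _ => ?_
    rw [integral_finsetSum _ fun k _ => hI j k]
    refine Finset.sum_congr rfl fun k _ => ?_
    rw [integral_const_mul, integral_one_sub_cos_mul hH]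
  have h4 : ∫ ζ, ψ ζ = (1 / 2) * ∫ ζ, (ψ ζ + ψ (-ζ)) := by rw [h2]; ring
  rw [h4, h3, Finset.mul_sum, Finset.mul_sum]
  refine Finset.sum_congr rfl fun j _ => ?_
  rw [Finset.mul_sum, Finset.mul_sum]
  refine Finset.sum_congr rfl fun k _ => ?_
  ring

/-! ### Second moments of linear combinations of fractional Brownian motion -/

section FBM

variable {Ω : Type*} [MeasurableSpace Ω] {P : Measure Ω} {H : ℝ} {B : ℝ → Ω → ℝ}

lemma IsFBM.memLp (hB : IsFBM H B P) (x : ℝ) : MemLp (B x) 2 P :=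
  (hB.gaussian.hasGaussianLaw_eval x).memLp_two

/-- Rows and columns of `d j * conj (d k)` sum to zero, which kills the terms `|x j|^(2H)` and `|x
k|^(2H)` of the covariance. -/
lemma IsFBM.integral_normSq_sum (hB : IsFBM H B P) {ι : Type*} [Fintype ι] {d : ι → ℂ}
    (hd : ∑ j, d j = 0) (x : ι → ℝ) :
    ∫ w, ‖∑ j, d j * (B (x j) w : ℂ)‖ ^ 2 ∂P =
      ∑ j, ∑ k, -(1 / 2) * (d j * (starRingEnd ℂ) (d k)).re * |x j - x k| ^ (2 * H) := by
  have hI : ∀ j k, Integrable (fun w => (d j * (starRingEnd ℂ) (d k)).re *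
      (B (x j) w * B (x k) w)) P := fun j k =>
    ((hB.memLp (x j)).integrable_mul (hB.memLp (x k))).const_mul _
  have hpt : ∀ w, ‖∑ j, d j * (B (x j) w : ℂ)‖ ^ 2 =
      ∑ j, ∑ k, (d j * (starRingEnd ℂ) (d k)).re * (B (x j) w * B (x k) w) := by
    intro w
    rw [normSq_sum]
    refine Finset.sum_congr rfl fun j _ => Finset.sum_congr rfl fun k _ => ?_
    rw [map_mul, Complex.conj_ofReal, mul_mul_mul_comm, ← Complex.ofReal_mul,
      Complex.re_mul_ofReal]
  simp only [hpt]
  rw [integral_finsetSum _ fun j _ => integrable_finsetSum _ fun k _ => hI j k]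
  have h1 : ∀ j, ∫ w, ∑ k, (d j * (starRingEnd ℂ) (d k)).re * (B (x j) w * B (x k) w) ∂P =
      ∑ k, (d j * (starRingEnd ℂ) (d k)).re *
        ((|x j| ^ (2 * H) + |x k| ^ (2 * H) - |x j - x k| ^ (2 * H)) / 2) := by
    intro j
    rw [integral_finsetSum _ fun k _ => hI j k]
    refine Finset.sum_congr rfl fun k _ => ?_
    rw [integral_const_mul, hB.covariance]
  simp only [h1]
  have hrow : ∀ j, ∑ k, (d j * (starRingEnd ℂ) (d k)).re = 0 := by
    intro j
    rw [← Complex.re_sum, ← Finset.mul_sum, ← map_sum, hd]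
    simp
  have hcol : ∀ k, ∑ j, (d j * (starRingEnd ℂ) (d k)).re = 0 := by
    intro k
    rw [← Complex.re_sum, ← Finset.sum_mul, hd]
    simp
  have e1 : ∑ j, ∑ k, (d j * (starRingEnd ℂ) (d k)).re * |x j| ^ (2 * H) = 0 := by
    simp only [← Finset.sum_mul, hrow, zero_mul, Finset.sum_const_zero]
  have e2 : ∑ j, ∑ k, (d j * (starRingEnd ℂ) (d k)).re * |x k| ^ (2 * H) = 0 := by
    rw [Finset.sum_comm]
    simp only [← Finset.sum_mul, hcol, zero_mul, Finset.sum_const_zero]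
  have e3 : ∑ j, ∑ k, (d j * (starRingEnd ℂ) (d k)).re *
        ((|x j| ^ (2 * H) + |x k| ^ (2 * H) - |x j - x k| ^ (2 * H)) / 2) =
      ∑ j, ∑ k, (-(1 / 2) * (d j * (starRingEnd ℂ) (d k)).re * |x j - x k| ^ (2 * H)) +
      (1 / 2) * (∑ j, ∑ k, (d j * (starRingEnd ℂ) (d k)).re * |x j| ^ (2 * H)) +
      (1 / 2) * (∑ j, ∑ k, (d j * (starRingEnd ℂ) (d k)).re * |x k| ^ (2 * H)) := by
    simp only [Finset.mul_sum, ← Finset.sum_add_distrib]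
    refine Finset.sum_congr rfl fun j _ => Finset.sum_congr rfl fun k _ => ?_
    ring
  rw [e3, e1, e2]
  ring

end FBM

/-! ### Step functions -/

/-- The difference of two step functions. -/
def StepFn.sub (φ ψ : StepFn) : StepFn where
  size := φ.size + ψ.size
  c := Fin.append φ.c fun i => -ψ.c i
  a := Fin.append φ.a ψ.a
  b := Fin.append φ.b ψ.b
  le i := by
    refine Fin.addCases (fun i => ?_) (fun i => ?_) i
    · simpa using φ.le i
    · simpa using ψ.le i

lemma StepFn.toFun_sub (φ ψ : StepFn) (y : ℝ) :
    (φ.sub ψ).toFun y = φ.toFun y - ψ.toFun y := by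
  rw [StepFn.toFun, StepFn.toFun, StepFn.toFun, sub_eq_add_neg, ← Finset.sum_neg_distrib]
  refine (Fin.sum_univ_add (a := φ.size) (b := ψ.size) _).trans ?_
  simp only [StepFn.sub, Fin.append_left, Fin.append_right]
  congr 1
  refine Finset.sum_congr rfl fun i _ => ?_
  simp only [Set.indicator]
  split_ifs <;> simp

lemma StepFn.integral_sub {Ω : Type*} (φ ψ : StepFn) (B : ℝ → Ω → ℝ) (w : Ω) :
    (φ.sub ψ).integral B w = φ.integral B w - ψ.integral B w := by
  rw [StepFn.integral, StepFn.integral, StepFn.integral, sub_eq_add_neg,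
    ← Finset.sum_neg_distrib]
  refine (Fin.sum_univ_add (a := φ.size) (b := ψ.size) _).trans ?_
  simp only [StepFn.sub, Fin.append_left, Fin.append_right]
  congr 1
  refine Finset.sum_congr rfl fun i _ => ?_
  ring

lemma StepFn.integrable (φ : StepFn) : Integrable φ.toFun := by
  unfold StepFn.toFun
  refine integrable_finsetSum _ fun i _ => ?_
  exact (integrable_indicator_iff measurableSet_Ioc).2 (integrableOn_const (by simp))

/-- The coefficients of the values of the integrator in an elementary integral. -/
def StepFn.coeff (φ : StepFn) : Fin φ.size ⊕ Fin φ.size → ℂ := Sum.elim φ.c fun i => -φ.c i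

/-- The points at which the integrator is evaluated in an elementary integral. -/
def StepFn.node (φ : StepFn) : Fin φ.size ⊕ Fin φ.size → ℝ := Sum.elim φ.b φ.a

lemma StepFn.sum_coeff (φ : StepFn) : ∑ j, φ.coeff j = 0 := by
  simp [StepFn.coeff, Fintype.sum_sum_type]

lemma StepFn.integral_eq {Ω : Type*} (φ : StepFn) (B : ℝ → Ω → ℝ) (w : Ω) :
    φ.integral B w = ∑ j, φ.coeff j * (B (φ.node j) w : ℂ) := by
  simp only [StepFn.integral, StepFn.coeff, StepFn.node, Fintype.sum_sum_type, Sum.elim_inl,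
    Sum.elim_inr, ← Finset.sum_add_distrib]
  refine Finset.sum_congr rfl fun i _ => ?_
  push_cast
  ring

/-! ### The Fourier transform -/

lemma norm_exp_neg_I_mul (ζ y : ℝ) : ‖Complex.exp (-(Complex.I * ζ * y))‖ = 1 := by
  rw [Complex.norm_exp]; simp

lemma integrable_mul_exp {g : ℝ → ℂ} (hg : Integrable g) (ζ : ℝ) :
    Integrable fun y : ℝ => g y * Complex.exp (-(Complex.I * ζ * y)) := by
  refine hg.mul_bdd (c := 1) (by fun_prop) (.of_forall fun y => ?_)
  exact (norm_exp_neg_I_mul ζ y).le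

lemma fourierInt_sub {f g : ℝ → ℂ} (hf : Integrable f) (hg : Integrable g) (ζ : ℝ) :
    fourierInt (fun y => f y - g y) ζ = fourierInt f ζ - fourierInt g ζ := by
  simp only [fourierInt, sub_mul]
  exact integral_sub (integrable_mul_exp hf ζ) (integrable_mul_exp hg ζ)

lemma continuous_fourierInt {g : ℝ → ℂ} (hg : Integrable g) : Continuous (fourierInt g) := by
  refine continuous_of_dominated (bound := fun y => ‖g y‖)
    (fun ζ => (integrable_mul_exp hg ζ).aestronglyMeasurable) (fun ζ => .of_forall fun y => ?_)
    hg.norm (.of_forall fun y => by fun_prop)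
  rw [norm_mul, norm_exp_neg_I_mul, mul_one]

lemma integral_exp_neg_I_mul {ζ : ℝ} (hζ : ζ ≠ 0) (a b : ℝ) :
    ∫ y in a..b, Complex.exp (-(Complex.I * ζ * y)) =
      (Complex.exp (-(Complex.I * ζ * b)) - Complex.exp (-(Complex.I * ζ * a))) /
        (-(Complex.I * ζ)) := by
  have h : -(Complex.I * (ζ : ℂ)) ≠ 0 := by simp [hζ]
  have := integral_exp_mul_complex (a := a) (b := b) h
  simpa only [neg_mul] using this

lemma StepFn.fourierInt_eq_sum (φ : StepFn) (ζ : ℝ) :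
    fourierInt φ.toFun ζ =
      ∑ i, φ.c i * ∫ y in φ.a i..φ.b i, Complex.exp (-(Complex.I * ζ * y)) := by
  have h1 : ∀ i, Integrable fun y : ℝ => (Set.Ioc (φ.a i) (φ.b i)).indicator
      (fun y : ℝ => φ.c i * Complex.exp (-(Complex.I * ζ * y))) y := by
    intro i
    refine (integrable_indicator_iff measurableSet_Ioc).2 ?_
    exact (Continuous.integrableOn_Icc (by fun_prop)).mono_set Set.Ioc_subset_Icc_self
  have h2 : fourierInt φ.toFun ζ = ∫ y : ℝ, ∑ i, (Set.Ioc (φ.a i) (φ.b i)).indicator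
      (fun y : ℝ => φ.c i * Complex.exp (-(Complex.I * ζ * y))) y := by
    refine integral_congr_ae (.of_forall fun y => ?_)
    simp only [StepFn.toFun, Finset.sum_mul]
    refine Finset.sum_congr rfl fun i _ => ?_
    simp only [Set.indicator]
    split_ifs <;> simp
  rw [h2, integral_finsetSum _ fun i _ => h1 i]
  refine Finset.sum_congr rfl fun i _ => ?_
  rw [integral_indicator measurableSet_Ioc, ← intervalIntegral.integral_of_le (φ.le i),
    intervalIntegral.integral_const_mul]

/-- The coefficients and nodes are those of `StepFn.integral_eq`, so the step function and its
elementary integral are governed by the same sum. -/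
lemma StepFn.fourierInt_eq (φ : StepFn) {ζ : ℝ} (hζ : ζ ≠ 0) :
    fourierInt φ.toFun ζ =
      (∑ j, φ.coeff j * Complex.exp (-(Complex.I * ζ * φ.node j))) / (-(Complex.I * ζ)) := by
  rw [φ.fourierInt_eq_sum]
  simp only [StepFn.coeff, StepFn.node, Fintype.sum_sum_type, Sum.elim_inl,
    Sum.elim_inr, ← Finset.sum_add_distrib, Finset.sum_div]
  refine Finset.sum_congr rfl fun i _ => ?_
  rw [integral_exp_neg_I_mul hζ]
  ring

/-! ### The isometry -/

/-- The measure `|ζ|^{1-2H} dζ`. -/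
noncomputable def sobolevMeasure (H : ℝ) : Measure ℝ :=
  volume.withDensity fun ζ => ENNReal.ofReal (|ζ| ^ (1 - 2 * H))

lemma eLpNorm_two_sq {α E : Type*} [MeasurableSpace α] [NormedAddCommGroup E] (f : α → E)
    (μ : Measure α) : eLpNorm f 2 μ ^ 2 = ∫⁻ x, ‖f x‖ₑ ^ 2 ∂μ := by
  simpa using eLpNorm_nnreal_pow_eq_lintegral (f := f) (μ := μ) (p := 2) (by norm_num)

lemma eLpNorm_two_sq_eq_ofReal {α E : Type*} [MeasurableSpace α] [NormedAddCommGroup E]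
    {f : α → E} {μ : Measure α} (hf : MemLp f 2 μ) :
    eLpNorm f 2 μ ^ 2 = ENNReal.ofReal (∫ x, ‖f x‖ ^ 2 ∂μ) := by
  rw [eLpNorm_two_sq, ofReal_integral_eq_lintegral_ofReal
    ((memLp_two_iff_integrable_sq_norm hf.1).1 hf)
    (.of_forall fun x => by positivity)]
  refine lintegral_congr fun x => ?_
  rw [ENNReal.ofReal_pow (norm_nonneg _), ofReal_norm]

lemma sobolevSq_eq {H : ℝ} {g : ℝ → ℂ} (hg : Integrable g) :
    sobolevSq H g = eLpNorm (fourierInt g) 2 (sobolevMeasure H) ^ 2 := by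
  have hm : Measurable (fourierInt g) := (continuous_fourierInt hg).measurable
  rw [eLpNorm_two_sq, sobolevMeasure, lintegral_withDensity_eq_lintegral_mul _ (by fun_prop)
    (by fun_prop), sobolevSq]
  refine lintegral_congr fun ζ => ?_
  rw [Pi.mul_apply, mul_comm]

section FBM

variable {Ω : Type*} [MeasurableSpace Ω] {P : Measure Ω} {H : ℝ} {B : ℝ → Ω → ℝ}

lemma StepFn.memLp_integral (hB : IsFBM H B P) (φ : StepFn) : MemLp (φ.integral B) 2 P := by
  have : φ.integral B = fun w => ∑ j, φ.coeff j * (B (φ.node j) w : ℂ) :=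
    funext fun w => φ.integral_eq B w
  rw [this]
  exact memLp_finsetSum _ fun j _ => (hB.memLp (φ.node j)).ofReal.const_mul _

/-- The factor `1/|ζ|²` from the Fourier transform turns the weight `|ζ|^(1-2H)` into `|ζ|^(-1-2H)`;
both sides then reduce to the same quadratic form in `|x j - x k|^(2H)`. -/
lemma StepFn.sobolevSq_eq_integral (hH : H ∈ Set.Ioo (0 : ℝ) 1) (hB : IsFBM H B P)
    (φ : StepFn) : sobolevSq H φ.toFun =
      ENNReal.ofReal (2 * oscConst H) * eLpNorm (φ.integral B) 2 P ^ 2 := by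
  rw [eLpNorm_two_sq_eq_ofReal (φ.memLp_integral hB)]
  simp only [φ.integral_eq B]
  rw [hB.integral_normSq_sum φ.sum_coeff,
    ← ENNReal.ofReal_mul (mul_nonneg zero_le_two (oscConst_pos hH).le)]
  obtain ⟨h1, h2⟩ := integrable_and_integral_normSq_trigSum hH φ.sum_coeff φ.node
  rw [← h2, ofReal_integral_eq_lintegral_ofReal h1 (.of_forall fun ζ => by positivity), sobolevSq]
  refine lintegral_congr_ae ?_
  filter_upwards [compl_mem_ae_iff.2 (measure_singleton (0 : ℝ))] with ζ hζ
  have hζ : ζ ≠ 0 := hζ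
  rw [φ.fourierInt_eq hζ, ← ofReal_norm, ← ENNReal.ofReal_pow (norm_nonneg _),
    ← ENNReal.ofReal_mul (by positivity), rpow_split hζ, norm_div, norm_neg, norm_mul,
    Complex.norm_I, one_mul, Complex.norm_real, div_pow, Real.norm_eq_abs, sq_abs]
  congr 1
  ring

/-- The isometry: the `L²(P)`-norm of an elementary integral. -/
lemma StepFn.eLpNorm_integral (hH : H ∈ Set.Ioo (0 : ℝ) 1) (hB : IsFBM H B P) (φ : StepFn) :
    eLpNorm (fourierInt φ.toFun) 2 (sobolevMeasure H) =
      ENNReal.ofReal (√(2 * oscConst H)) * eLpNorm (φ.integral B) 2 P := by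
  have h := φ.sobolevSq_eq_integral hH hB
  rw [sobolevSq_eq φ.integrable] at h
  have h2 : ENNReal.ofReal (2 * oscConst H) = ENNReal.ofReal (√(2 * oscConst H)) ^ 2 := by
    rw [← ENNReal.ofReal_pow (Real.sqrt_nonneg _), Real.sq_sqrt]
    exact mul_nonneg zero_le_two (oscConst_pos hH).le
  rw [h2, ← mul_pow] at h
  exact (ENNReal.pow_right_strictMono two_ne_zero).injective h

end FBM

/-! ### The stochastic integral -/

section StochIntegral

variable {Ω : Type*} [MeasurableSpace Ω] {P : Measure Ω} {H : ℝ} {B : ℝ → Ω → ℝ}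

/-- The seminorm of order `1/2 - H` as an `L²`-seminorm. -/
noncomputable def sobolevNorm (H : ℝ) (g : ℝ → ℂ) : ℝ≥0∞ :=
  eLpNorm (fourierInt g) 2 (sobolevMeasure H)

lemma sobolevNorm_sub_le {f g : ℝ → ℂ} (hf : Integrable f) (hg : Integrable g) :
    sobolevNorm H (fun y => f y - g y) ≤ sobolevNorm H f + sobolevNorm H g := by
  have h : fourierInt (fun y => f y - g y) = fourierInt f - fourierInt g :=
    funext fun ζ => fourierInt_sub hf hg ζ
  rw [sobolevNorm, h]
  exact eLpNorm_sub_le (continuous_fourierInt hf).aestronglyMeasurable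
    (continuous_fourierInt hg).aestronglyMeasurable one_le_two

lemma sobolevNorm_le_sub_add {f g : ℝ → ℂ} (hf : Integrable f) (hg : Integrable g) :
    sobolevNorm H f ≤ sobolevNorm H (fun y => f y - g y) + sobolevNorm H g := by
  have h : fourierInt f = fourierInt (fun y => f y - g y) + fourierInt g := by
    ext ζ
    rw [Pi.add_apply, fourierInt_sub hf hg, sub_add_cancel]
  rw [sobolevNorm, h]
  exact eLpNorm_add_le (continuous_fourierInt (hf.sub hg)).aestronglyMeasurable
    (continuous_fourierInt hg).aestronglyMeasurable one_le_two

lemma tendsto_sobolevNorm {ι : Type*} {l : Filter ι} {g : ι → ℝ → ℂ}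
    (hg : ∀ k, Integrable (g k)) :
    Tendsto (fun k => sobolevNorm H (g k)) l (𝓝 0) ↔
      Tendsto (fun k => sobolevSq H (g k)) l (𝓝 0) := by
  have e : ∀ k, sobolevSq H (g k) = sobolevNorm H (g k) ^ 2 := fun k => sobolevSq_eq (hg k)
  simp only [e]
  constructor
  · intro h
    simpa using ENNReal.Tendsto.pow (n := 2) h
  · intro h
    have h1 := (ENNReal.continuous_rpow_const (y := (1 / 2 : ℝ))).tendsto 0 |>.comp h
    rw [ENNReal.zero_rpow_of_pos (by norm_num)] at h1
    refine h1.congr fun k => ?_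
    rw [Function.comp_apply, ← ENNReal.rpow_natCast, ← ENNReal.rpow_mul]
    norm_num

/-- The isometry constant is `√(2 * oscConst H)`. -/
noncomputable def isoConst (H : ℝ) : ℝ≥0∞ := ENNReal.ofReal (√(2 * oscConst H))

lemma isoConst_ne_zero (hH : H ∈ Set.Ioo (0 : ℝ) 1) : isoConst H ≠ 0 := by
  have := oscConst_pos hH
  simp only [isoConst, ne_eq, ENNReal.ofReal_eq_zero, not_le]
  positivity

lemma isoConst_ne_top : isoConst H ≠ ∞ := ENNReal.ofReal_ne_top

lemma StepFn.sobolevNorm_eq (hH : H ∈ Set.Ioo (0 : ℝ) 1) (hB : IsFBM H B P) (φ : StepFn) :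
    sobolevNorm H φ.toFun = isoConst H * eLpNorm (φ.integral B) 2 P :=
  φ.eLpNorm_integral hH hB

/-- The isometry for the stochastic integral. -/
lemma IsStochIntegral.sobolevNorm_eq (hH : H ∈ Set.Ioo (0 : ℝ) 1) (hB : IsFBM H B P)
    {g : ℝ → ℂ} {J : Ω → ℂ} (h : IsStochIntegral H B P g J) :
    sobolevNorm H g = isoConst H * eLpNorm J 2 P := by
  obtain ⟨hg, hJ, φ, h1, h2⟩ := h
  have hgφ : ∀ k, Integrable fun y => g y - (φ k).toFun y := fun k => hg.sub (φ k).integrable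
  have hIφ : ∀ k, MemLp ((φ k).integral B) 2 P := fun k => (φ k).memLp_integral hB
  rw [← tendsto_sobolevNorm hgφ] at h1
  have h3 := ENNReal.Tendsto.const_mul (a := isoConst H) h2 (.inr isoConst_ne_top)
  rw [mul_zero] at h3
  -- Each inequality is a triangle inequality through `φ k`, where the isometry is known, with error
  -- terms that tend to 0.
  apply le_antisymm
  · have h4 := (h1.add h3).add_const (isoConst H * eLpNorm J 2 P)
    rw [zero_add, zero_add] at h4
    refine ge_of_tendsto' h4 fun k => ?_
    refine (sobolevNorm_le_sub_add hg (φ k).integrable).trans ?_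
    rw [(φ k).sobolevNorm_eq hH hB, add_assoc, ← mul_add]
    gcongr
    calc eLpNorm ((φ k).integral B) 2 P
        = eLpNorm (J - fun w => J w - (φ k).integral B w) 2 P := by congr 1; ext; simp
      _ ≤ _ := by
        rw [add_comm]
        exact eLpNorm_sub_le hJ.1 (hJ.1.sub (hIφ k).1) one_le_two
  · have h4 := (h3.add h1).add_const (sobolevNorm H g)
    rw [zero_add, zero_add] at h4
    refine ge_of_tendsto' h4 fun k => ?_
    calc isoConst H * eLpNorm J 2 P
        = isoConst H * eLpNorm ((fun w => J w - (φ k).integral B w) + (φ k).integral B) 2 P := by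
          congr 2; ext; simp
      _ ≤ isoConst H * (eLpNorm (fun w => J w - (φ k).integral B w) 2 P +
          eLpNorm ((φ k).integral B) 2 P) := by
          gcongr
          exact eLpNorm_add_le (hJ.1.sub (hIφ k).1) (hIφ k).1 one_le_two
      _ ≤ _ := by
          rw [mul_add, add_assoc, ← (φ k).sobolevNorm_eq hH hB]
          gcongr
          calc sobolevNorm H (φ k).toFun
              = sobolevNorm H (fun y => g y - (fun y => g y - (φ k).toFun y) y) := by
                congr 1; ext; simp
            _ ≤ _ := by
                rw [add_comm]
                exact sobolevNorm_sub_le hg (hgφ k)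

lemma IsStochIntegral.sub (hB : IsFBM H B P) {g g' : ℝ → ℂ} {J J' : Ω → ℂ}
    (h : IsStochIntegral H B P g J) (h' : IsStochIntegral H B P g' J') :
    IsStochIntegral H B P (fun y => g y - g' y) (J - J') := by
  obtain ⟨hg, hJ, φ, h1, h2⟩ := h
  obtain ⟨hg', hJ', φ', h1', h2'⟩ := h'
  have hgφ : ∀ k, Integrable fun y => g y - (φ k).toFun y := fun k => hg.sub (φ k).integrable
  have hgφ' : ∀ k, Integrable fun y => g' y - (φ' k).toFun y :=
    fun k => hg'.sub (φ' k).integrable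
  rw [← tendsto_sobolevNorm hgφ] at h1
  rw [← tendsto_sobolevNorm hgφ'] at h1'
  refine ⟨hg.sub hg', hJ.sub hJ', fun k => (φ k).sub (φ' k), ?_, ?_⟩
  · have hi : ∀ k, Integrable fun y => g y - g' y - ((φ k).sub (φ' k)).toFun y :=
      fun k => (hg.sub hg').sub (StepFn.integrable _)
    rw [← tendsto_sobolevNorm hi]
    refine tendsto_of_tendsto_of_tendsto_of_le_of_le tendsto_const_nhds
      (by simpa using h1.add h1') (fun _ => zero_le) fun k => ?_
    refine le_of_eq_of_le ?_ (sobolevNorm_sub_le (hgφ k) (hgφ' k))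
    congr 1
    ext y
    rw [StepFn.toFun_sub]
    ring
  · refine tendsto_of_tendsto_of_tendsto_of_le_of_le tendsto_const_nhds
      (by simpa using h2.add h2') (fun _ => zero_le) fun k => ?_
    refine le_of_eq_of_le ?_ (eLpNorm_sub_le (hJ.1.sub ((φ k).memLp_integral hB).1)
      (hJ'.1.sub ((φ' k).memLp_integral hB).1) one_le_two)
    congr 1
    ext w
    simp only [StepFn.integral_sub, Pi.sub_apply]
    ring

/-- Uniqueness of the stochastic integral. -/
lemma IsStochIntegral.ae_eq (hH : H ∈ Set.Ioo (0 : ℝ) 1) (hB : IsFBM H B P)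
    {g : ℝ → ℂ} {J J' : Ω → ℂ} (h : IsStochIntegral H B P g J)
    (h' : IsStochIntegral H B P g J') : J =ᵐ[P] J' := by
  -- `J - J'` is a stochastic integral of the zero function, so the isometry forces its norm to
  -- vanish.
  have h0 := (h.sub hB h').sobolevNorm_eq hH hB
  have hz : fourierInt (fun y => g y - g y) = 0 := by ext; simp [fourierInt]
  rw [sobolevNorm, hz, eLpNorm_zero, eq_comm, mul_eq_zero, or_iff_right (isoConst_ne_zero hH),
    eLpNorm_eq_zero_iff (h.2.1.sub h'.2.1).1 two_ne_zero] at h0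
  filter_upwards [h0] with w hw
  exact sub_eq_zero.1 hw

lemma StepFn.integral_centered [IsProbabilityMeasure P] (hB : IsFBM H B P) (φ : StepFn) :
    ∫ w, φ.integral B w ∂P = 0 := by
  have h : ∀ x, Integrable (B x) P := fun x => (hB.memLp x).integrable one_le_two
  simp only [φ.integral_eq B]
  rw [integral_finsetSum _ fun j _ => ((h _).ofReal).const_mul _]
  refine Finset.sum_eq_zero fun j _ => ?_
  rw [integral_const_mul, integral_complex_ofReal, hB.centered]
  simp

/-- On a probability space mean square convergence implies convergence in `L¹`, hence of
expectations. -/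
lemma IsStochIntegral.centered [IsProbabilityMeasure P] (hB : IsFBM H B P)
    {g : ℝ → ℂ} {J : Ω → ℂ} (h : IsStochIntegral H B P g J) : ∫ w, J w ∂P = 0 := by
  obtain ⟨hg, hJ, φ, h1, h2⟩ := h
  have hIφ : ∀ k, MemLp ((φ k).integral B) 2 P := fun k => (φ k).memLp_integral hB
  have h3 : Tendsto (fun k => eLpNorm ((φ k).integral B - J) 1 P) atTop (𝓝 0) := by
    refine tendsto_of_tendsto_of_tendsto_of_le_of_le tendsto_const_nhds h2
      (fun _ => zero_le) fun k => ?_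
    rw [eLpNorm_sub_comm]
    exact eLpNorm_le_eLpNorm_of_exponent_le one_le_two (hJ.1.sub (hIφ k).1)
  have h4 := tendsto_integral_of_L1' J (hJ.integrable one_le_two).1
    (.of_forall fun k => (hIφ k).integrable one_le_two) h3
  simp only [fun k => (φ k).integral_centered hB] at h4
  exact tendsto_nhds_unique h4 tendsto_const_nhds

/-- Existence of the stochastic integral of a function that is approximable by step functions. -/
lemma exists_isStochIntegral (hH : H ∈ Set.Ioo (0 : ℝ) 1) (hB : IsFBM H B P)
    {g : ℝ → ℂ} (hg : Integrable g) {φ : ℕ → StepFn}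
    (h : Tendsto (fun k => sobolevSq H (fun y => g y - (φ k).toFun y)) atTop (𝓝 0)) :
    ∃ J, IsStochIntegral H B P g J := by
  have hgφ : ∀ k, Integrable fun y => g y - (φ k).toFun y := fun k => hg.sub (φ k).integrable
  have hIφ : ∀ k, MemLp ((φ k).integral B) 2 P := fun k => (φ k).memLp_integral hB
  have h1 := (tendsto_sobolevNorm hgφ).2 h
  -- The isometry, applied to differences of step functions, makes the elementary integrals a Cauchy
  -- sequence in `L²(P)`.
  have hle : ∀ k l, eLpNorm ((φ k).integral B - (φ l).integral B) 2 P ≤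
      (isoConst H)⁻¹ * (sobolevNorm H (fun y => g y - (φ k).toFun y) +
        sobolevNorm H (fun y => g y - (φ l).toFun y)) := by
    intro k l
    rw [mul_comm, ← div_eq_mul_inv, ENNReal.le_div_iff_mul_le (.inl (isoConst_ne_zero hH))
      (.inl isoConst_ne_top), mul_comm]
    have e : (φ k).integral B - (φ l).integral B = ((φ k).sub (φ l)).integral B := by
      ext w
      rw [StepFn.integral_sub, Pi.sub_apply]
    rw [e, ← StepFn.sobolevNorm_eq hH hB, add_comm]
    refine le_of_eq_of_le ?_ (sobolevNorm_sub_le (hgφ l) (hgφ k))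
    congr 1
    ext y
    rw [StepFn.toFun_sub]
    ring
  have hc : CauchySeq fun k => (hIφ k).toLp := by
    rw [Lp.cauchySeq_Lp_iff_cauchySeq_eLpNorm]
    have h5 : Tendsto (fun n : ℕ × ℕ => (isoConst H)⁻¹ *
        (sobolevNorm H (fun y => g y - (φ n.1).toFun y) +
        sobolevNorm H (fun y => g y - (φ n.2).toFun y))) atTop (𝓝 0) := by
      rw [← prod_atTop_atTop_eq]
      have := ENNReal.Tendsto.const_mul (a := (isoConst H)⁻¹)
        ((h1.comp tendsto_fst).add (h1.comp tendsto_snd))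
        (.inr (ENNReal.inv_ne_top.2 (isoConst_ne_zero hH)))
      simpa using this
    refine tendsto_of_tendsto_of_tendsto_of_le_of_le tendsto_const_nhds h5
      (fun _ => zero_le) fun n => ?_
    refine le_of_eq_of_le (eLpNorm_congr_ae ?_) (hle n.1 n.2)
    exact (hIφ n.1).coeFn_toLp.sub (hIφ n.2).coeFn_toLp
  obtain ⟨J, hJ⟩ := cauchySeq_tendsto_of_complete hc
  refine ⟨J, hg, Lp.memLp J, φ, h, ?_⟩
  rw [Lp.tendsto_Lp_iff_tendsto_eLpNorm'] at hJ
  refine hJ.congr fun k => ?_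
  rw [eLpNorm_sub_comm]
  exact eLpNorm_congr_ae ((ae_eq_refl _).sub (hIφ k).coeFn_toLp)

lemma stochIntegral_spec {g : ℝ → ℂ} (h : ∃ J, IsStochIntegral H B P g J) :
    IsStochIntegral H B P g (stochIntegral H B P g) := by
  rw [stochIntegral, dif_pos h]
  exact h.choose_spec

end StochIntegral

/-! ### Approximation by step functions -/

section Approx

variable {g g' : ℝ → ℂ} {L : ℝ}

lemma norm_sub_le_of_deriv_le (hg : ∀ y, HasDerivAt g (g' y) y)
    (hL : ∀ y ∈ Set.Icc (0 : ℝ) 1, ‖g' y‖ ≤ L) {x y : ℝ} (hx : x ∈ Set.Icc (0 : ℝ) 1)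
    (hy : y ∈ Set.Icc (0 : ℝ) 1) : ‖g y - g x‖ ≤ L * |y - x| := by
  simpa using (convex_Icc (0 : ℝ) 1).norm_image_sub_le_of_norm_hasDerivWithin_le
    (fun z _ => (hg z).hasDerivWithinAt) hL hx hy

lemma norm_cell_le (hg : ∀ y, HasDerivAt g (g' y) y)
    (hL : ∀ y ∈ Set.Icc (0 : ℝ) 1, ‖g' y‖ ≤ L) {a b : ℝ} (ha : 0 ≤ a) (hab : a ≤ b)
    (hb : b ≤ 1) (ζ : ℝ) :
    ‖∫ y in a..b, (g y - g b) * Complex.exp (-(Complex.I * ζ * y))‖ ≤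
      L * (b - a) * (b - a) := by
  have hL0 : 0 ≤ L := (norm_nonneg _).trans (hL 0 (by simp))
  have := intervalIntegral.norm_integral_le_of_norm_le_const (a := a) (b := b)
    (C := L * (b - a)) (f := fun y : ℝ => (g y - g b) * Complex.exp (-(Complex.I * ζ * y)))
    fun y hy => by
      rw [Set.uIoc_of_le hab] at hy
      rw [norm_mul, norm_exp_neg_I_mul, mul_one]
      refine (norm_sub_le_of_deriv_le hg hL (x := b) (y := y) ⟨ha.trans hab, hb⟩
        ⟨ha.trans hy.1.le, hy.2.trans hb⟩).trans ?_
      rw [abs_sub_comm, abs_of_nonneg (by linarith [hy.2])]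
      gcongr
      exact hy.1.le
  rwa [abs_of_nonneg (by linarith)] at this

/-- One integration by parts gains `1/|ζ|`. The boundary term at `b` vanishes; the one at `a` and
the integral of `g'` each contribute `L * (b - a) / |ζ|`. -/
lemma norm_cell_le_div (hg : ∀ y, HasDerivAt g (g' y) y) (hg' : Continuous g')
    (hL : ∀ y ∈ Set.Icc (0 : ℝ) 1, ‖g' y‖ ≤ L) {a b : ℝ} (ha : 0 ≤ a) (hab : a ≤ b)
    (hb : b ≤ 1) {ζ : ℝ} (hζ : ζ ≠ 0) :
    ‖∫ y in a..b, (g y - g b) * Complex.exp (-(Complex.I * ζ * y))‖ ≤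
      2 * L * (b - a) / |ζ| := by
  have hc : -(Complex.I * (ζ : ℂ)) ≠ 0 := by simp [hζ]
  have hcn : ‖-(Complex.I * (ζ : ℂ))‖ = |ζ| := by simp
  set v : ℝ → ℂ := fun y => Complex.exp (-(Complex.I * ζ * y)) / (-(Complex.I * ζ)) with hv
  have hvd : ∀ y : ℝ, HasDerivAt v (Complex.exp (-(Complex.I * ζ * y))) y := by
    intro y
    have h1 : HasDerivAt (fun y : ℝ => -(Complex.I * ζ * (y : ℂ))) (-(Complex.I * ζ)) y := by
      simpa using ((Complex.ofRealCLM.hasDerivAt (x := y)).const_mul (-(Complex.I * ζ)))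
    have h2 := (h1.cexp).div_const (-(Complex.I * ζ))
    rwa [mul_div_cancel_right₀ _ hc] at h2
  have hvn : ∀ y, ‖v y‖ = 1 / |ζ| := by
    intro y
    rw [hv, norm_div, norm_exp_neg_I_mul, hcn]
  have hvc : Continuous v := by fun_prop
  have hparts := intervalIntegral.integral_mul_deriv_eq_deriv_mul (a := a) (b := b)
    (u := fun y => g y - g b) (u' := g') (v := v)
    (v' := fun y : ℝ => Complex.exp (-(Complex.I * ζ * y)))
    (fun y _ => (hg y).sub_const _) (fun y _ => hvd y) (hg'.intervalIntegrable _ _)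
    (Continuous.intervalIntegrable (by fun_prop) _ _)
  rw [hparts, sub_self, zero_mul, zero_sub]
  have h1 : ‖(g a - g b) * v a‖ ≤ L * (b - a) * (1 / |ζ|) := by
    rw [norm_mul, hvn]
    gcongr
    have := norm_sub_le_of_deriv_le hg hL (x := b) (y := a) ⟨ha.trans hab, hb⟩
      ⟨ha, hab.trans hb⟩
    rwa [abs_sub_comm, abs_of_nonneg (by linarith)] at this
  have h2 : ‖∫ y in a..b, g' y * v y‖ ≤ L * (1 / |ζ|) * (b - a) := by
    have := intervalIntegral.norm_integral_le_of_norm_le_const (a := a) (b := b)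
      (C := L * (1 / |ζ|)) (f := fun y : ℝ => g' y * v y) fun y hy => by
        rw [Set.uIoc_of_le hab] at hy
        rw [norm_mul, hvn]
        gcongr
        exact hL y ⟨ha.trans hy.1.le, hy.2.trans hb⟩
    rwa [abs_of_nonneg (sub_nonneg.2 hab)] at this
  calc _ ≤ ‖(g a - g b) * v a‖ + ‖∫ y in a..b, g' y * v y‖ := by
        rw [← norm_neg ((g a - g b) * v a)]
        exact norm_sub_le _ _
    _ ≤ _ := (add_le_add h1 h2).trans (le_of_eq (by ring))

/-- The step function that interpolates `g` on `(0, 1]` at the right end points of `N` cells. -/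
noncomputable def stepApprox (g : ℝ → ℂ) (N : ℕ) : StepFn where
  size := N
  c i := g (((i + 1 : ℕ) : ℝ) / N)
  a i := ((i : ℕ) : ℝ) / N
  b i := ((i + 1 : ℕ) : ℝ) / N
  le i := by gcongr; simp

lemma integrable_indicator_Ioo (hg : Continuous g) :
    Integrable ((Set.Ioo (0 : ℝ) 1).indicator g) :=
  (integrable_indicator_iff measurableSet_Ioo).2
    (hg.integrableOn_Icc.mono_set Set.Ioo_subset_Icc_self)

lemma fourierInt_indicator_Ioo (g : ℝ → ℂ) (ζ : ℝ) :
    fourierInt ((Set.Ioo (0 : ℝ) 1).indicator g) ζ =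
      ∫ y in (0 : ℝ)..1, g y * Complex.exp (-(Complex.I * ζ * y)) := by
  rw [intervalIntegral.integral_of_le zero_le_one, integral_Ioc_eq_integral_Ioo,
    ← integral_indicator measurableSet_Ioo, fourierInt]
  refine integral_congr_ae (.of_forall fun y => ?_)
  simp only [Set.indicator]
  split_ifs <;> simp

lemma fourierInt_sub_stepApprox (hg : Continuous g) {N : ℕ} (hN : N ≠ 0) (ζ : ℝ) :
    fourierInt (fun y => (Set.Ioo (0 : ℝ) 1).indicator g y - (stepApprox g N).toFun y) ζ =
      ∑ i ∈ Finset.range N, ∫ y in (i : ℝ) / N..((i + 1 : ℕ) : ℝ) / N,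
        (g y - g (((i + 1 : ℕ) : ℝ) / N)) * Complex.exp (-(Complex.I * ζ * y)) := by
  have hN' : (N : ℝ) ≠ 0 := by exact_mod_cast hN
  have hsum := intervalIntegral.sum_integral_adjacent_intervals (μ := volume) (n := N)
    (a := fun i : ℕ => (i : ℝ) / N)
    (f := fun y : ℝ => g y * Complex.exp (-(Complex.I * ζ * y)))
    fun k _ => Continuous.intervalIntegrable (by fun_prop) _ _
  simp only [Nat.cast_zero, zero_div, div_self hN'] at hsum
  rw [fourierInt_sub (integrable_indicator_Ioo hg) (StepFn.integrable _),
    fourierInt_indicator_Ioo, ← hsum, StepFn.fourierInt_eq_sum]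
  have h2 : ∑ i, (stepApprox g N).c i * ∫ y in (stepApprox g N).a i..(stepApprox g N).b i,
      Complex.exp (-(Complex.I * ζ * y)) = ∑ i ∈ Finset.range N, g (((i + 1 : ℕ) : ℝ) / N) *
      ∫ y in (i : ℝ) / N..((i + 1 : ℕ) : ℝ) / N, Complex.exp (-(Complex.I * ζ * y)) :=
    Fin.sum_univ_eq_sum_range (fun i : ℕ => g (((i + 1 : ℕ) : ℝ) / N) *
      ∫ y in (i : ℝ) / N..((i + 1 : ℕ) : ℝ) / N, Complex.exp (-(Complex.I * ζ * y))) N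
  rw [h2, ← Finset.sum_sub_distrib]
  refine Finset.sum_congr rfl fun i _ => ?_
  rw [← intervalIntegral.integral_const_mul, ← intervalIntegral.integral_sub
    (Continuous.intervalIntegrable (by fun_prop) _ _)
    (Continuous.intervalIntegrable (by fun_prop) _ _)]
  simp only [sub_mul]

/-- The first bound gives pointwise convergence, the second decay in `ζ` uniformly in `N`: the two
inputs of dominated convergence. -/
lemma norm_fourierInt_sub_stepApprox_le (hg : ∀ y, HasDerivAt g (g' y) y) (hg' : Continuous g')
    (hL : ∀ y ∈ Set.Icc (0 : ℝ) 1, ‖g' y‖ ≤ L) {N : ℕ} (hN : N ≠ 0) (ζ : ℝ) :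
    ‖fourierInt (fun y => (Set.Ioo (0 : ℝ) 1).indicator g y - (stepApprox g N).toFun y) ζ‖ ≤
      L / N ∧
    (ζ ≠ 0 →
    ‖fourierInt (fun y => (Set.Ioo (0 : ℝ) 1).indicator g y - (stepApprox g N).toFun y) ζ‖ ≤
      2 * L / |ζ|) := by
  have hN' : (0 : ℝ) < N := by exact_mod_cast Nat.pos_of_ne_zero hN
  have hgc : Continuous g := continuous_iff_continuousAt.2 fun y => (hg y).continuousAt
  have hlen : ∀ i : ℕ, ((i + 1 : ℕ) : ℝ) / N - (i : ℝ) / N = 1 / N := by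
    intro i; push_cast; ring
  have hle : ∀ i : ℕ, (i : ℝ) / N ≤ ((i + 1 : ℕ) : ℝ) / N := by
    intro i; gcongr; simp
  have hone : ∀ i ∈ Finset.range N, ((i + 1 : ℕ) : ℝ) / N ≤ 1 := by
    intro i hi
    rw [div_le_one hN']
    exact_mod_cast Finset.mem_range.1 hi
  rw [fourierInt_sub_stepApprox hgc hN]
  constructor
  · refine (norm_sum_le_of_le _ fun i hi =>
      norm_cell_le hg hL (by positivity) (hle i) (hone i hi) ζ).trans (le_of_eq ?_)
    simp only [hlen, Finset.sum_const, Finset.card_range, nsmul_eq_mul]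
    field_simp
  · intro hζ
    refine (norm_sum_le_of_le _ fun i hi =>
      norm_cell_le_div hg hg' hL (by positivity) (hle i) (hone i hi) hζ).trans (le_of_eq ?_)
    simp only [hlen, Finset.sum_const, Finset.card_range, nsmul_eq_mul]
    field_simp

/-- A continuously differentiable function on the unit interval is approximated by step functions
in the seminorm of order `1/2 - H`. -/
lemma tendsto_sobolevSq_stepApprox {H : ℝ} (hH : H ∈ Set.Ioo (0 : ℝ) 1)
    (hg : ∀ y, HasDerivAt g (g' y) y) (hg' : Continuous g') :
    Tendsto (fun k : ℕ => sobolevSq H (fun y => (Set.Ioo (0 : ℝ) 1).indicator g y -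
      (stepApprox g (k + 1)).toFun y)) atTop (𝓝 0) := by
  obtain ⟨L, hL⟩ := isCompact_Icc.exists_bound_of_continuousOn (s := Set.Icc (0 : ℝ) 1)
    hg'.continuousOn
  have hL0 : 0 ≤ L := (norm_nonneg _).trans (hL 0 (by simp))
  have hgc : Continuous g := continuous_iff_continuousAt.2 fun y => (hg y).continuousAt
  have hbd := fun (k : ℕ) ζ => norm_fourierInt_sub_stepApprox_le hg hg' hL (k.succ_ne_zero) ζ
  set h : ℕ → ℝ → ℂ := fun k => fourierInt (fun y => (Set.Ioo (0 : ℝ) 1).indicator g y -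
    (stepApprox g (k + 1)).toFun y) with hh
  have hm : ∀ k, Measurable (h k) := fun k => (continuous_fourierInt
    ((integrable_indicator_Ioo hgc).sub (StepFn.integrable _))).measurable
  have hconv : ∀ (k : ℕ) ζ, ‖h k ζ‖ₑ ^ 2 * ENNReal.ofReal (|ζ| ^ (1 - 2 * H)) =
      ENNReal.ofReal (‖h k ζ‖ ^ 2 * |ζ| ^ (1 - 2 * H)) := by
    intro k ζ
    rw [ENNReal.ofReal_mul (by positivity), ENNReal.ofReal_pow (norm_nonneg _), ofReal_norm]
  -- The constant `5 * L ^ 2` is the sum of the bounds `‖h‖² ≤ L²` and `‖h‖² ζ² ≤ 4 L²`.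
  have hlim := tendsto_lintegral_of_dominated_convergence (μ := volume)
    (F := fun k ζ => ‖h k ζ‖ₑ ^ 2 * ENNReal.ofReal (|ζ| ^ (1 - 2 * H))) (f := fun _ => 0)
    (fun ζ => ENNReal.ofReal (5 * L ^ 2 * ((1 + ζ ^ 2)⁻¹ * |ζ| ^ (1 - 2 * H))))
    (fun k => by have := hm k; fun_prop) (fun k => .of_forall fun ζ => ?_) ?_
    (.of_forall fun ζ => ?_)
  · simpa [sobolevSq, hh] using hlim
  · simp only [hconv]
    refine ENNReal.ofReal_le_ofReal ?_
    rw [← mul_assoc]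
    gcongr
    rw [← div_eq_mul_inv, le_div_iff₀ (by positivity)]
    have h1 : ‖h k ζ‖ ≤ L := ((hbd k ζ).1).trans
      (div_le_self hL0 (by push_cast; linarith [(Nat.cast_nonneg k : (0 : ℝ) ≤ k)]))
    have h2 : ‖h k ζ‖ * |ζ| ≤ 2 * L := by
      rcases eq_or_ne ζ 0 with rfl | hζ
      · simpa using hL0
      · rw [← le_div_iff₀ (abs_pos.2 hζ)]
        exact (hbd k ζ).2 hζ
    have h3 : ‖h k ζ‖ ^ 2 ≤ L ^ 2 := by gcongr
    have h4 : (‖h k ζ‖ * |ζ|) ^ 2 ≤ (2 * L) ^ 2 := by gcongr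
    rw [mul_pow, sq_abs] at h4
    linarith
  · rw [← ofReal_integral_eq_lintegral_ofReal ((integrable_weight hH).const_mul _)
      (.of_forall fun ζ => by positivity)]
    exact ENNReal.ofReal_ne_top
  · simp only [hconv]
    rw [← ENNReal.ofReal_zero]
    refine (ENNReal.continuous_ofReal.tendsto 0).comp ?_
    have h1 : Tendsto (fun k : ℕ => L / ((k + 1 : ℕ) : ℝ)) atTop (𝓝 0) :=
      (tendsto_const_div_atTop_nhds_zero_nat L).comp (tendsto_add_atTop_nat 1)
    have h2 : Tendsto (fun k => ‖h k ζ‖) atTop (𝓝 0) :=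
      squeeze_zero (fun _ => norm_nonneg _) (fun k => (hbd k ζ).1) h1
    simpa using (h2.pow 2).mul_const (|ζ| ^ (1 - 2 * H))

/-- A function whose Fourier transform does not vanish at the origin has positive seminorm. -/
lemma sobolevNorm_ne_zero {H : ℝ} (hg : Integrable g) (h0 : fourierInt g 0 ≠ 0) :
    sobolevNorm H g ≠ 0 := by
  intro h
  have hc := continuous_fourierInt hg
  have h1 : sobolevSq H g = 0 := by
    rw [sobolevSq_eq hg, ← sobolevNorm, h, zero_pow two_ne_zero]
  have hm := hc.measurable
  rw [sobolevSq, lintegral_eq_zero_iff (by fun_prop)] at h1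
  have h2 : fourierInt g =ᵐ[volume] fun _ => 0 := by
    filter_upwards [h1, compl_mem_ae_iff.2 (measure_singleton (0 : ℝ))] with ζ hζ hζ0
    have hζ0 : ζ ≠ 0 := hζ0
    have h3 : 0 < |ζ| ^ (1 - 2 * H) := Real.rpow_pos_of_pos (abs_pos.2 hζ0) _
    simpa [h3.not_ge] using hζ
  -- Continuity upgrades vanishing almost everywhere to vanishing at the origin.
  exact h0 (congrFun ((Continuous.ae_eq_iff_eq volume hc continuous_const).1 h2) 0)

end Approx

/-! ### The symbol and the Green function -/

section Green

variable {n : ℕ} {α : Fin n → ℝ}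

/-- The argument of `iω` is `±π/2`, so the imaginary parts `±|ω|^(α k) * sin (π α k / 2)` never have
opposite signs. The first is nonzero because `0 < α 0 < 2`; an exponent 2 contributes zero. -/
lemma im_freqSymbol_ne_zero [NeZero n] (hα_range : ∀ k, α k ∈ Set.Ioc (0 : ℝ) 2)
    (hα_first : α 0 < 2) {ω : ℝ} (hω : ω ≠ 0) : (freqSymbol α ω).im ≠ 0 := by
  have hnn : ∀ k, 0 ≤ Real.sin (Real.pi / 2 * α k) := fun k =>
    Real.sin_nonneg_of_nonneg_of_le_pi (by have := (hα_range k).1; positivity)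
      (by nlinarith [(hα_range k).2, Real.pi_pos])
  have hpos : 0 < Real.sin (Real.pi / 2 * α 0) :=
    Real.sin_pos_of_pos_of_lt_pi (by have := (hα_range 0).1; positivity)
      (by nlinarith [Real.pi_pos])
  have hnorm : ∀ k, 0 < ‖Complex.I * (ω : ℂ)‖ ^ α k := fun k =>
    Real.rpow_pos_of_pos (by simpa using hω) _
  have hsum : 0 < ∑ k, ‖Complex.I * (ω : ℂ)‖ ^ α k * Real.sin (Real.pi / 2 * α k) :=
    Finset.sum_pos' (fun k _ => mul_nonneg (hnorm k).le (hnn k))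
      ⟨0, Finset.mem_univ _, mul_pos (hnorm 0) hpos⟩
  rw [freqSymbol, Complex.im_sum]
  simp only [Complex.cpow_ofReal_im]
  rcases hω.lt_or_gt with h | h
  · have harg : Complex.arg (Complex.I * (ω : ℂ)) = -(Real.pi / 2) := by
      rw [show Complex.I * (ω : ℂ) = ((-ω : ℝ) : ℂ) * -Complex.I by push_cast; ring,
        Complex.arg_real_mul _ (neg_pos.2 h), Complex.arg_neg_I]
    simp only [harg, neg_mul, Real.sin_neg, mul_neg, Finset.sum_neg_distrib]
    exact (neg_neg_of_pos hsum).ne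
  · have harg : Complex.arg (Complex.I * (ω : ℂ)) = Real.pi / 2 := by
      rw [mul_comm, Complex.arg_real_mul _ h, Complex.arg_I]
    simpa only [harg] using hsum.ne'

/-- A purely imaginary root would have a real square. -/
lemma re_sqrtSymbol_ne_zero [NeZero n] (hα_range : ∀ k, α k ∈ Set.Ioc (0 : ℝ) 2)
    (hα_first : α 0 < 2) {ω : ℝ} (hω : ω ≠ 0) : (sqrtSymbol α ω).re ≠ 0 := by
  have h := im_freqSymbol_ne_zero hα_range hα_first hω
  have h2 : sqrtSymbol α ω ^ 2 = freqSymbol α ω := by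
    simp [sqrtSymbol]
  intro h0
  apply h
  rw [← h2, pow_two, Complex.mul_im, h0]
  ring

/-- The perfect square reduces nonvanishing of the mean to `exp r ≠ 1`. -/
lemma integral_exp_sub_exp {r : ℂ} (hr : r ≠ 0) :
    ∫ y in (0 : ℝ)..1, (Complex.exp (r * y) - Complex.exp (r * (2 - y))) =
      -((Complex.exp r - 1) ^ 2 / r) := by
  have h1 : ∫ y in (0 : ℝ)..1, Complex.exp (r * y) = (Complex.exp r - 1) / r := by
    rw [integral_exp_mul_complex hr]; simp
  have h2 : ∫ y in (0 : ℝ)..1, Complex.exp (r * (2 - y)) =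
      (Complex.exp r ^ 2 - Complex.exp r) / r := by
    have e : ∀ y : ℝ, Complex.exp (r * (2 - y)) =
        Complex.exp r ^ 2 * Complex.exp (-r * y) := by
      intro y
      rw [← Complex.exp_nat_mul, ← Complex.exp_add]
      congr 1
      push_cast
      ring
    simp only [e]
    rw [intervalIntegral.integral_const_mul, integral_exp_mul_complex (neg_ne_zero.2 hr)]
    have h3 : Complex.exp r ≠ 0 := Complex.exp_ne_zero r
    simp only [Complex.ofReal_one, mul_one, Complex.ofReal_zero, mul_zero, Complex.exp_zero,
      Complex.exp_neg]
    field_simp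
    ring
  rw [intervalIntegral.integral_sub (Continuous.intervalIntegrable (by fun_prop) _ _)
    (Continuous.intervalIntegrable (by fun_prop) _ _), h1, h2]
  field_simp
  ring

/-- On the interval the Green function with pole at the boundary is smooth, and its mean does not
vanish. -/
lemma exists_smooth_greenExt [NeZero n] (hα_range : ∀ k, α k ∈ Set.Ioc (0 : ℝ) 2)
    (hα_first : α 0 < 2) (ω : ℝ) :
    ∃ g g' : ℝ → ℂ, (∀ y, HasDerivAt g (g' y) y) ∧ Continuous g' ∧
      greenExt α ω 0 = (Set.Ioo (0 : ℝ) 1).indicator g ∧ ∫ y in (0 : ℝ)..1, g y ≠ 0 := by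
  rcases eq_or_ne ω 0 with rfl | hω
  · refine ⟨fun y => (y : ℂ) - 1, fun _ => 1, fun y => ?_, continuous_const, ?_, ?_⟩
    · simpa using (Complex.ofRealCLM.hasDerivAt (x := y)).sub_const 1
    · refine Set.indicator_congr fun y hy => ?_
      simp [green, max_eq_right hy.1.le]
    · have h : ∫ y in (0 : ℝ)..1, ((y : ℂ) - 1) = ((∫ y in (0 : ℝ)..1, (y - 1) : ℝ) : ℂ) := by
        rw [← intervalIntegral.integral_ofReal]
        simp
      rw [h, Complex.ofReal_ne_zero, intervalIntegral.integral_sub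
        (Continuous.intervalIntegrable (by fun_prop) _ _)
        (Continuous.intervalIntegrable (by fun_prop) _ _)]
      norm_num
  · have hre := re_sqrtSymbol_ne_zero hα_range hα_first hω
    set r := sqrtSymbol α ω with hr
    have hr0 : r ≠ 0 := by
      rintro h
      exact hre (by rw [h]; rfl)
    -- `Re r ≠ 0` keeps `exp r` and `exp (2 * r)` off the unit circle, so neither the mean nor the
    -- denominator of the Green function vanishes.
    have hexp : ‖Complex.exp r‖ ≠ 1 := by
      rw [Complex.norm_exp, ne_eq, Real.exp_eq_one_iff]
      exact hre
    have hexp1 : Complex.exp r - 1 ≠ 0 := by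
      intro h
      exact hexp (by rw [sub_eq_zero.1 h, norm_one])
    have hexp2 : 1 + Complex.exp (2 * r) ≠ 0 := by
      intro h
      have h1 : Complex.exp (2 * r) = -1 := by linear_combination h
      have h2 : ‖Complex.exp (2 * r)‖ = 1 := by rw [h1, norm_neg, norm_one]
      rw [Complex.norm_exp, Real.exp_eq_one_iff] at h2
      exact hre (by simpa using h2)
    -- At `x = 0` and `y > 0` the four exponentials coincide in pairs, which cancels the 2 in the
    -- denominator.
    set c : ℂ := 1 / (r * (1 + Complex.exp (2 * r))) with hc
    have hc0 : c ≠ 0 := one_div_ne_zero (mul_ne_zero hr0 hexp2)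
    refine ⟨fun y => c * (Complex.exp (r * y) - Complex.exp (r * (2 - y))),
      fun y => c * (Complex.exp (r * y) * r - Complex.exp (r * (2 - y)) * -r), fun y => ?_,
      by fun_prop, ?_, ?_⟩
    · have hid : HasDerivAt (fun y : ℝ => (y : ℂ)) 1 y := Complex.ofRealCLM.hasDerivAt
      have h1 : HasDerivAt (fun y : ℝ => r * (y : ℂ)) r y := by simpa using hid.const_mul r
      have h2 : HasDerivAt (fun y : ℝ => r * (2 - (y : ℂ))) (-r) y := by
        simpa using (hid.const_sub 2).const_mul r
      exact (h1.cexp.sub h2.cexp).const_mul c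
    · refine Set.indicator_congr fun y hy => ?_
      simp only [green, if_neg hω, ← hr, zero_add, zero_sub, abs_neg, abs_of_pos hy.1, sub_zero]
      push_cast
      rw [hc]
      field_simp
      ring
    · rw [intervalIntegral.integral_const_mul, integral_exp_sub_exp hr0]
      exact mul_ne_zero hc0 (neg_ne_zero.2 (div_ne_zero (pow_ne_zero 2 hexp1) hr0))

end Green

/-! ### The boundary data -/

section Main

variable {Ω : Type*} [MeasurableSpace Ω] {P : Measure Ω} {H : ℝ} {B : ℝ → Ω → ℝ}
  {n : ℕ} {α : Fin n → ℝ}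

lemma isStochIntegral_greenIntegral [NeZero n] (hH : H ∈ Set.Ioo (0 : ℝ) 1) (hB : IsFBM H B P)
    (hα_range : ∀ k, α k ∈ Set.Ioc (0 : ℝ) 2) (hα_first : α 0 < 2) (ω : ℝ) :
    IsStochIntegral H B P (greenExt α ω 0) (greenIntegral H B P α ω 0) := by
  obtain ⟨g, g', hg, hg', he, -⟩ := exists_smooth_greenExt hα_range hα_first ω
  have hgc : Continuous g := continuous_iff_continuousAt.2 fun y => (hg y).continuousAt
  refine stochIntegral_spec ?_
  rw [he]
  exact exists_isStochIntegral hH hB (integrable_indicator_Ioo hgc)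
    (tendsto_sobolevSq_stepApprox hH hg hg')

lemma ofReal_R_eq {ω : ℝ}
    (h : IsStochIntegral H B P (greenExt α ω 0) (greenIntegral H B P α ω 0)) :
    ENNReal.ofReal (R H B P α ω) = eLpNorm (greenIntegral H B P α ω 0) 2 P ^ 2 :=
  (eLpNorm_two_sq_eq_ofReal h.2.1).symm

lemma R_nonneg (ω : ℝ) : 0 ≤ R H B P α ω := integral_nonneg fun _ => by positivity

lemma R_pos [NeZero n] (hH : H ∈ Set.Ioo (0 : ℝ) 1) (hB : IsFBM H B P)
    (hα_range : ∀ k, α k ∈ Set.Ioc (0 : ℝ) 2) (hα_first : α 0 < 2) (ω : ℝ) :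
    0 < R H B P α ω := by
  have h := isStochIntegral_greenIntegral hH hB hα_range hα_first ω
  obtain ⟨g, g', hg, hg', he, hne⟩ := exists_smooth_greenExt hα_range hα_first ω
  have hF : fourierInt (greenExt α ω 0) 0 ≠ 0 := by
    rw [he, fourierInt_indicator_Ioo]
    simpa using hne
  have h1 := sobolevNorm_ne_zero (H := H) h.1 hF
  rw [h.sobolevNorm_eq hH hB] at h1
  rw [← ENNReal.ofReal_pos, ofReal_R_eq h]
  exact pos_iff_ne_zero.2 (pow_ne_zero 2 (right_ne_zero_of_mul h1))

/-- `R` does not depend on the fractional Brownian motion. -/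
lemma R_eq {Ω' : Type*} [MeasurableSpace Ω'] {P' : Measure Ω'} {B' : ℝ → Ω' → ℝ} [NeZero n]
    (hH : H ∈ Set.Ioo (0 : ℝ) 1) (hB : IsFBM H B P) (hB' : IsFBM H B' P')
    (hα_range : ∀ k, α k ∈ Set.Ioc (0 : ℝ) 2) (hα_first : α 0 < 2) (ω : ℝ) :
    R H B P α ω = R H B' P' α ω := by
  have h := isStochIntegral_greenIntegral hH hB hα_range hα_first ω
  have h' := isStochIntegral_greenIntegral hH hB' hα_range hα_first ω
  -- Both norms are tied to the deterministic seminorm of the same integrand by the same constant.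
  have h1 := (h.sobolevNorm_eq hH hB).symm.trans (h'.sobolevNorm_eq hH hB')
  rw [ENNReal.mul_right_inj (isoConst_ne_zero hH) isoConst_ne_top] at h1
  rw [← ENNReal.ofReal_eq_ofReal_iff (R_nonneg ω) (R_nonneg ω), ofReal_R_eq h, ofReal_R_eq h', h1]

/-- The stochastic integral is centered and `F ω` is a deterministic factor, so the variance is a
second moment. -/
lemma cVar_mildSolution [IsProbabilityMeasure P] [NeZero n] (hH : H ∈ Set.Ioo (0 : ℝ) 1)
    (hB : IsFBM H B P) (hα_range : ∀ k, α k ∈ Set.Ioc (0 : ℝ) 2) (hα_first : α 0 < 2)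
    (F : ℝ → ℂ) (ω : ℝ) :
    cVar (mildSolution H B P α F 0 ω) P = ‖F ω‖ ^ 2 * R H B P α ω := by
  have h := isStochIntegral_greenIntegral hH hB hα_range hα_first ω
  have h0 : ∫ w, mildSolution H B P α F 0 ω w ∂P = 0 := by
    simp only [mildSolution]
    rw [integral_const_mul, h.centered hB, mul_zero]
  rw [cVar, h0, R, ← integral_const_mul]
  simp only [mildSolution, sub_zero, norm_mul, norm_neg, mul_pow]

lemma norm_source_eq [IsProbabilityMeasure P] [NeZero n] (hH : H ∈ Set.Ioo (0 : ℝ) 1)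
    (hB : IsFBM H B P) (hα_range : ∀ k, α k ∈ Set.Ioc (0 : ℝ) 2) (hα_first : α 0 < 2)
    (F : ℝ → ℂ) (ω : ℝ) :
    ‖F ω‖ = (cVar (mildSolution H B P α F 0 ω) P / R H B P α ω) ^ (1 / 2 : ℝ) := by
  rw [cVar_mildSolution hH hB hα_range hα_first,
    mul_div_cancel_right₀ _ (R_pos hH hB hα_range hα_first ω).ne', ← Real.sqrt_eq_rpow,
    Real.sqrt_sq (norm_nonneg _)]

end Main

end RandomSource

theorem mainTheorem3 {Ω : Type*} [MeasurableSpace Ω] (P : Measure Ω) [IsProbabilityMeasure P]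
    (H : ℝ) (hH : H ∈ Set.Ioo (0 : ℝ) 1) (B : ℝ → Ω → ℝ) (hB : RandomSource.IsFBM H B P)
    (n : ℕ) [NeZero n] (α : Fin n → ℝ) (hα : StrictMono α)
    (hα_range : ∀ k, α k ∈ Set.Ioc (0 : ℝ) 2) (hα_first : α 0 < 2) :
    -- the stochastic integral is well defined, and `R` is positive
    (∀ ω : ℝ,
      RandomSource.IsStochIntegral H B P (RandomSource.greenExt α ω 0)
        (RandomSource.greenIntegral H B P α ω 0) ∧
      (∀ J : Ω → ℂ, RandomSource.IsStochIntegral H B P (RandomSource.greenExt α ω 0) J →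
        J =ᵐ[P] RandomSource.greenIntegral H B P α ω 0) ∧
      0 < RandomSource.R H B P α ω) ∧
    -- the reconstruction formula
    (∀ f F : ℝ → ℂ, RandomSource.IsSourceFourier f F → ∀ ω : ℝ,
      ‖F ω‖ = (RandomSource.cVar (RandomSource.mildSolution H B P α F 0 ω) P
        / RandomSource.R H B P α ω) ^ (1 / 2 : ℝ)) ∧
    -- uniqueness for the inverse problem: the variance of the boundary data determines `|f̂|`
    -- (the two sets of data may come from different fractional Brownian motions of index `H`)
    (∀ {Ω' : Type*} [MeasurableSpace Ω'] (P' : Measure Ω') [IsProbabilityMeasure P']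
      (B' : ℝ → Ω' → ℝ), RandomSource.IsFBM H B' P' →
      ∀ f F f' F' : ℝ → ℂ, RandomSource.IsSourceFourier f F →
        RandomSource.IsSourceFourier f' F' → ∀ ω : ℝ,
        RandomSource.cVar (RandomSource.mildSolution H B P α F 0 ω) P =
          RandomSource.cVar (RandomSource.mildSolution H B' P' α F' 0 ω) P' →
        ‖F ω‖ = ‖F' ω‖) := by
  refine ⟨fun ω => ⟨?_, fun J hJ => ?_, ?_⟩, fun f F _ ω => ?_, ?_⟩
  · exact RandomSource.isStochIntegral_greenIntegral hH hB hα_range hα_first ω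
  · exact hJ.ae_eq hH hB (RandomSource.isStochIntegral_greenIntegral hH hB hα_range hα_first ω)
  · exact RandomSource.R_pos hH hB hα_range hα_first ω
  · exact RandomSource.norm_source_eq hH hB hα_range hα_first F ω
  · intro Ω' _ P' _ B' hB' f F f' F' _ _ ω hV
    rw [RandomSource.norm_source_eq hH hB hα_range hα_first F ω,
      RandomSource.norm_source_eq hH hB' hα_range hα_first F' ω, hV,
      RandomSource.R_eq hH hB hB' hα_range hα_first ω]
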